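/- Let $k$ be a field and let $A$ be a finite-dimensional unital associative $k$-algebra that is self-injective (that is, $A$ is injective as a right module over itself) and has no semisimple blocks (that is, $A$ is not isomorphic, as a $k$-algebra, to a product $A_1\times A_2$ with $A_1$ a nonzero semisimple algebra). Let $\underline{\mathrm{mod}}\text{-}A$ be the stable module category: the quotient of the category of finitely generated right $A$-modules by the ideal of homomorphisms that factor through a projective module. For a $k$-algebra automorphism $\varphi$ of $A$, let $\underline{\mathrm{res}}_\varphi$ be the endofunctor of $\underline{\mathrm{mod}}\text{-}A$ induced by $M\mapsto M_\varphi$, where $M_\varphi$ is the vector space $M$ with the action $m*a=m\,\varphi(a)$; call $\varphi$ stably inner if $\underline{\mathrm{res}}_\varphi$ is isomorphic to the identity functor of $\underline{\mathrm{mod}}\text{-}A$. For a two-sided ideal $I$ of $A$, let $(0:I)=\{a\in A\mid aI=0\}$. Then for every two-sided ideal $I$ of $A$ and every stably inner automorphism $\varphi$ of $A$ we have $\varphi(I)=I$, and $\varphi$ induces an inner automorphism of the quotient algebra $\bar A=A/((0:I)+I)$: there is a $k$-algebra automorphism $\psi$ of $\bar A$ with $\psi(\bar a)=\overline{\varphi(a)}$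 for all $a\in A$, and an invertible $u\in\bar A$ with $\psi(x)=u^{-1}xu$ for all $x\in\bar A$. -/

import Mathlib

open CategoryTheory

universe v u

/-! ### The stable module category

Everything is stated for left modules over a ring `R`; right `A`-modules are modules over `Aᵐᵒᵖ`. -/

section StableCategory

variable {R : Type u} [Ring R]

/-- A homomorphism of finitely generated modules lies in `𝒫(M, N)` if it can be written as a
composition `M ⟶ P ⟶ N` with `P` a (finitely generated) projective module. -/
def FactorsThroughProjective {M N : FGModuleCat.{u} R} (f : M ⟶ N) : Prop :=
  ∃ (P : FGModuleCat.{u} R) (_ : Module.Projective R P) (g : M ⟶ P) (h : P ⟶ N), f = g ≫ h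

/-- Two parallel homomorphisms are identified in the stable category if their difference
lies in `𝒫(M, N)`. -/
def stableRel (R : Type u) [Ring R] : HomRel (FGModuleCat.{u} R) :=
  fun _ _ f g ↦ FactorsThroughProjective (f - g)

theorem factorsThroughProjective_zero (M N : FGModuleCat.{u} R) :
    FactorsThroughProjective (0 : M ⟶ N) :=
  ⟨FGModuleCat.of R PUnit.{u + 1},
    inferInstanceAs (Module.Projective R PUnit.{u + 1}), 0, 0, by simp⟩

theorem FactorsThroughProjective.neg {M N : FGModuleCat.{u} R} {f : M ⟶ N}
    (hf : FactorsThroughProjective f) : FactorsThroughProjective (-f) := by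
  obtain ⟨P, hP, g, h, rfl⟩ := hf
  exact ⟨P, hP, -g, h, by simp⟩

theorem FactorsThroughProjective.add {M N : FGModuleCat.{u} R} {f f' : M ⟶ N}
    (hf : FactorsThroughProjective f) (hf' : FactorsThroughProjective f') :
    FactorsThroughProjective (f + f') := by
  obtain ⟨P, hP, g, h, rfl⟩ := hf
  obtain ⟨P', hP', g', h', rfl⟩ := hf'
  refine ⟨FGModuleCat.of R (P × P'), inferInstanceAs (Module.Projective R (P × P')),
    FGModuleCat.ofHom (g.hom.hom.prod g'.hom.hom),
    FGModuleCat.ofHom (h.hom.hom.coprod h'.hom.hom), ?_⟩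
  ext x
  rfl

theorem FactorsThroughProjective.comp_left {L M N : FGModuleCat.{u} R} (e : L ⟶ M) {f : M ⟶ N}
    (hf : FactorsThroughProjective f) : FactorsThroughProjective (e ≫ f) := by
  obtain ⟨P, hP, g, h, rfl⟩ := hf
  exact ⟨P, hP, e ≫ g, h, by simp⟩

theorem FactorsThroughProjective.comp_right {L M N : FGModuleCat.{u} R} {f : L ⟶ M} (e : M ⟶ N)
    (hf : FactorsThroughProjective f) : FactorsThroughProjective (f ≫ e) := by
  obtain ⟨P, hP, g, h, rfl⟩ := hf
  exact ⟨P, hP, g, h ≫ e, by simp⟩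

instance stableRel_congruence : Congruence (stableRel R) where
  comp_left e f f' h := by
    have := FactorsThroughProjective.comp_left e h
    rwa [Preadditive.comp_sub] at this
  comp_right e h := by
    have := FactorsThroughProjective.comp_right e h
    rwa [Preadditive.sub_comp] at this
  equivalence :=
    { refl := fun f ↦ by
        have := factorsThroughProjective_zero (R := R)
        simpa [stableRel] using this _ _
      symm := fun h ↦ by
        have := FactorsThroughProjective.neg h
        rwa [neg_sub] at this
      trans := fun h h' ↦ by
        have := FactorsThroughProjective.add h h'
        rwa [sub_add_sub_cancel] at this }

/-- The stable module category: the quotient of the category of finitely generated modules by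
the ideal of homomorphisms that factor through a projective module. -/
abbrev StableModuleCat (R : Type u) [Ring R] : Type (u + 1) :=
  CategoryTheory.Quotient (stableRel R)

/-- The module `M_σ`: the additive group of `M`, on which `r` acts as `σ r` acts on `M`. -/
def Twist (_ : R ≃+* R) (M : Type u) : Type u := M

namespace Twist

variable (σ : R ≃+* R) (M : Type u) [AddCommGroup M]

instance : AddCommGroup (Twist σ M) := inferInstanceAs (AddCommGroup M)

/-- The identity map `M → M_σ`. -/
def equiv : M ≃+ Twist σ M := AddEquiv.refl M

variable [Module R M]

instance : Module R (Twist σ M) := Module.compHom M (σ : R →+* R)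

theorem smul_equiv (r : R) (x : M) : r • equiv σ M x = equiv σ M (σ r • x) := rfl

theorem equiv_smul (r : R) (x : M) : equiv σ M (r • x) = σ.symm r • equiv σ M x := by
  rw [smul_equiv, σ.apply_symm_apply]

instance [Module.Finite R M] : Module.Finite R (Twist σ M) := by
  have h : RingHomSurjective (σ.symm : R →+* R) := ⟨σ.symm.surjective⟩
  let e : M →ₛₗ[(σ.symm : R →+* R)] Twist σ M :=
    { (equiv σ M : M →+ Twist σ M) with map_smul' := equiv_smul σ M }
  exact Module.Finite.of_surjective e (equiv σ M).surjective

instance [Module.Projective R M] : Module.Projective R (Twist σ M) := by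
  let i₁ : RingHomInvPair (σ : R →+* R) (σ.symm : R →+* R) := RingHomInvPair.of_ringEquiv σ
  let i₂ : RingHomInvPair (σ.symm : R →+* R) (σ : R →+* R) := RingHomInvPair.symm _ _
  let e : M ≃ₛₗ[(σ.symm : R →+* R)] Twist σ M :=
    { equiv σ M with map_smul' := equiv_smul σ M }
  exact Module.Projective.of_equiv e

variable {M} {N : Type u} [AddCommGroup N] [Module R N]

/-- A homomorphism `M → N` regarded as a homomorphism `M_σ → N_σ`. -/
def map (f : M →ₗ[R] N) : Twist σ M →ₗ[R] Twist σ N where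
  toFun x := equiv σ N (f ((equiv σ M).symm x))
  map_add' x y := by simp
  map_smul' r x := by
    obtain ⟨x, rfl⟩ := (equiv σ M).surjective x
    simp [smul_equiv]

end Twist

/-- The restriction functor `res_σ` on finitely generated modules along an automorphism `σ` of
the ring, `M ↦ M_σ`. -/
def resFunctor (σ : R ≃+* R) : FGModuleCat.{u} R ⥤ FGModuleCat.{u} R where
  obj M := FGModuleCat.of R (Twist σ M)
  map f := FGModuleCat.ofHom (Twist.map σ f.hom.hom)
  map_id _ := rfl
  map_comp _ _ := rfl

theorem FactorsThroughProjective.res (σ : R ≃+* R) {M N : FGModuleCat.{u} R} {f : M ⟶ N}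
    (hf : FactorsThroughProjective f) : FactorsThroughProjective ((resFunctor σ).map f) := by
  obtain ⟨P, hP, g, h, rfl⟩ := hf
  exact ⟨(resFunctor σ).obj P, inferInstanceAs (Module.Projective R (Twist σ P)), (resFunctor σ).map g,
    (resFunctor σ).map h, by simp⟩

/-- The functor induced by `res_σ` on the stable module category. -/
def stableResFunctor (σ : R ≃+* R) : StableModuleCat R ⥤ StableModuleCat R :=
  CategoryTheory.Quotient.lift (stableRel R)
    (resFunctor σ ⋙ CategoryTheory.Quotient.functor (stableRel R))
    (fun _ _ _ _ h ↦ CategoryTheory.Quotient.sound (stableRel R)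
      (FactorsThroughProjective.res σ h))

end StableCategory

/-! ### Algebras and automorphisms -/

section Algebras

variable {k : Type v} [Field k] {A : Type u} [Ring A] [Algebra k A]

/-- An automorphism `φ` is stably inner if the functor that restriction along `φ` induces on the
stable category of finitely generated right modules is isomorphic to the identity functor. -/
def IsStablyInner (φ : A ≃ₐ[k] A) : Prop :=
  Nonempty (stableResFunctor (RingEquiv.op (φ : A ≃+* A)) ≅ 𝟭 (StableModuleCat Aᵐᵒᵖ))

/-- An automorphism `φ` is inner if `φ x = a⁻¹ x a` for some invertible `a`. -/
def IsInnerAut (φ : A ≃ₐ[k] A) : Prop :=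
  ∃ a : Aˣ, ∀ x : A, φ x = ↑a⁻¹ * x * ↑a

/-- `A` is self-injective: the right regular module is injective. -/
def IsSelfInjective (A : Type u) [Ring A] : Prop :=
  Module.Injective Aᵐᵒᵖ A

/-- `A` has no semisimple blocks: it is not a product `A₁ × A₂` of algebras with `A₁` a nonzero
semisimple algebra. -/
def HasNoSemisimpleBlocks (k : Type v) [Field k] (A : Type u) [Ring A] [Algebra k A] : Prop :=
  ¬ ∃ (A₁ A₂ : Type u) (_ : Ring A₁) (_ : Ring A₂) (_ : Algebra k A₁) (_ : Algebra k A₂),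
    Nontrivial A₁ ∧ IsSemisimpleRing A₁ ∧ Nonempty (A ≃ₐ[k] A₁ × A₂)

/-- The left annihilator `(0 : I) = {a | a I = 0}` of an ideal. -/
def leftAnnihilator (I : Ideal A) : Ideal A where
  carrier := {a | ∀ x ∈ I, a * x = 0}
  zero_mem' x _ := zero_mul x
  add_mem' ha hb x hx := by rw [add_mul, ha x hx, hb x hx, add_zero]
  smul_mem' c a ha x hx := by rw [smul_eq_mul, mul_assoc, ha x hx, mul_zero]

instance leftAnnihilator_isTwoSided (I : Ideal A) : (leftAnnihilator I).IsTwoSided where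
  mul_mem_of_left b ha x hx := by
    rw [mul_assoc]
    exact ha _ (I.mul_mem_left b hx)

instance leftAnnihilator_sup_isTwoSided (I : Ideal A) [I.IsTwoSided] :
    (leftAnnihilator I ⊔ I).IsTwoSided where
  mul_mem_of_left {a} b ha := by
    obtain ⟨y, hy, z, hz, rfl⟩ := Submodule.mem_sup.1 ha
    rw [add_mul]
    exact Submodule.add_mem_sup (Ideal.mul_mem_right b _ hy) (Ideal.mul_mem_right b _ hz)

end Algebras

section RadicalIdempotents

variable {R : Type u} [Ring R]

theorem isSemisimpleModule_of_jacobson_smul [IsSemiprimaryRing R] {M : Type*} [AddCommGroup M]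
    [Module R M] (h : ∀ j ∈ Ring.jacobson R, ∀ m : M, j • m = 0) : IsSemisimpleModule R M := by
  have hM : Module.IsTorsionBySet R M (Ring.jacobson R : Ideal R) := fun m j ↦ h j j.2 m
  let := hM.module
  exact hM.isSemisimpleModule_iff.1 inferInstance

/-- If `e` is an idempotent with `J e = 0`, every submodule of `R e` is a summand of `R e`. -/
theorem exists_complement_of_jacobson_mul_eq_zero [IsSemiprimaryRing R] {e : R}
    (he : e * e = e) (hJ : ∀ j ∈ Ring.jacobson R, j * e = 0) (N : Submodule R R)
    (hN : ∀ x ∈ N, x * e = x) :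
    ∃ y c : R, y ∈ N ∧ c * e = c ∧ y + c = e ∧ ∃ C : Submodule R R, c ∈ C ∧ Disjoint N C := by
  have hss : IsSemisimpleModule R (Submodule.span R {e}) := by
    refine isSemisimpleModule_of_jacobson_smul fun j hj m ↦ ?_
    obtain ⟨r, hr⟩ := Submodule.mem_span_singleton.1 m.2
    ext
    rw [Submodule.coe_smul, ← hr, smul_eq_mul, smul_eq_mul, ← mul_assoc]
    simpa using hJ _ (Ideal.mul_mem_right r _ hj)
  obtain ⟨C, hC⟩ := exists_isCompl (N.comap (Submodule.span R {e}).subtype)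
  have hle : N ≤ Submodule.span R {e} := fun x hx ↦
    Submodule.mem_span_singleton.2 ⟨x, hN x hx⟩
  obtain ⟨y, hy, c, hc, hyc⟩ := Submodule.mem_sup.1
    (hC.sup_eq_top ▸ Submodule.mem_top (x := (⟨e, Submodule.mem_span_singleton_self e⟩ :
      Submodule.span R {e})))
  refine ⟨y, c, hy, ?_, congrArg Subtype.val hyc, C.map (Submodule.subtype _),
    ⟨c, hc, rfl⟩, ?_⟩
  · obtain ⟨r, hr⟩ := Submodule.mem_span_singleton.1 c.2
    rw [← hr, smul_eq_mul, mul_assoc, he]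
  · rw [Submodule.disjoint_def]
    rintro _ hx ⟨z, hz, rfl⟩
    have := (Submodule.disjoint_def.1 hC.disjoint) z hx hz
    simp [this]

/-- If `R e` is semisimple, its elements are von Neumann regular. -/
theorem exists_mul_mul_self_eq [IsSemiprimaryRing R] {e : R}
    (he : e * e = e) (hJ : ∀ j ∈ Ring.jacobson R, j * e = 0) {x : R} (hx : x * e = x) :
    ∃ b, x * b * x = x := by
  obtain ⟨y, c, hy, -, hyc, C, hcC, hdis⟩ := exists_complement_of_jacobson_mul_eq_zero he hJ
    (Submodule.span R {x}) (by
      intro z hz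
      obtain ⟨r, rfl⟩ := Submodule.mem_span_singleton.1 hz
      rw [smul_eq_mul, mul_assoc, hx])
  obtain ⟨b, rfl⟩ := Submodule.mem_span_singleton.1 hy
  have h1 : x * c = x - x * b * x := by
    rw [eq_sub_of_add_eq' hyc, mul_sub, hx, smul_eq_mul, mul_assoc]
  have h2 : x * c = 0 := by
    refine Submodule.disjoint_def.1 hdis _ ?_ (C.smul_mem x hcC)
    rw [h1, Submodule.mem_span_singleton]
    exact ⟨1 - x * b, by rw [smul_eq_mul, sub_mul, one_mul]⟩
  exact ⟨b, (sub_eq_zero.1 (h1 ▸ h2)).symm⟩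

/-- If `R e` is semisimple and `R` is self-injective, elements `x ∈ e R` admit `b` with
`x b x = x` and `b e = b`. -/
theorem exists_mul_mul_self_eq_of_injective [IsSemiprimaryRing R] (hinj : Module.Injective R R)
    {e : R} (he : e * e = e) (hJ : ∀ j ∈ Ring.jacobson R, j * e = 0) {x : R} (hx : e * x = x) :
    ∃ b, b * e = b ∧ x * b * x = x := by
  obtain ⟨y, c, hy, hce, hyc, C, hcC, hdis⟩ := exists_complement_of_jacobson_mul_eq_zero he hJ
    (LinearMap.ker (LinearMap.toSpanSingleton R R x) ⊓ Submodule.span R {e}) (by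
      rintro z ⟨-, hz⟩
      obtain ⟨r, rfl⟩ := Submodule.mem_span_singleton.1 hz
      rw [smul_eq_mul, mul_assoc, he])
  have hyx : y * x = 0 := hy.1
  have hcx : c * x = x := by
    rw [eq_sub_of_add_eq' hyc, sub_mul, hyx, hx, sub_zero]
  let D : Submodule R R := Submodule.span R {c}
  have hDe : ∀ d ∈ D, d * e = d := by
    intro d hd
    obtain ⟨r, rfl⟩ := Submodule.mem_span_singleton.1 hd
    rw [smul_eq_mul, mul_assoc, hce]
  have hDC : D ≤ C := (Submodule.span_singleton_le_iff_mem _ _).2 hcC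
  obtain ⟨t, ht⟩ := hinj.out ((LinearMap.toSpanSingleton R R x).comp D.subtype) (by
    rw [← LinearMap.ker_eq_bot, LinearMap.ker_eq_bot']
    intro d hd
    ext
    refine Submodule.disjoint_def.1 hdis _ ⟨hd, ?_⟩ (hDC d.2)
    exact Submodule.mem_span_singleton.2 ⟨d, hDe d d.2⟩) D.subtype
  have h1 : x * t 1 = c := by
    have := ht ⟨c, Submodule.mem_span_singleton_self c⟩
    simp only [LinearMap.comp_apply, Submodule.subtype_apply, LinearMap.toSpanSingleton_apply,
      smul_eq_mul, hcx] at this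
    rw [← this, ← smul_eq_mul, ← map_smul, smul_eq_mul, mul_one]
  refine ⟨t 1 * e, by rw [mul_assoc, he], ?_⟩
  rw [← mul_assoc, h1, hce, hcx]

/-- A nonzero idempotent `e` with `J e = 0` can be chosen central: take `R e` maximal. -/
theorem exists_central_idempotent [IsArtinianRing R] (hinj : Module.Injective R R) {e₀ : R}
    (h₀ : e₀ * e₀ = e₀) (hJ₀ : ∀ j ∈ Ring.jacobson R, j * e₀ = 0) (hne : e₀ ≠ 0) :
    ∃ e : R, e * e = e ∧ (∀ j ∈ Ring.jacobson R, j * e = 0) ∧ e ≠ 0 ∧ ∀ a, a * e = e * a := by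
  let S : Set (Submodule R R) :=
    {N | ∃ e : R, (e * e = e ∧ (∀ j ∈ Ring.jacobson R, j * e = 0) ∧ e ≠ 0) ∧
      N = Submodule.span R {e}}
  obtain ⟨_, ⟨e, ⟨he, hJ, hne⟩, rfl⟩, hmax⟩ :=
    set_has_maximal_iff_noetherian.2 (inferInstance : IsNoetherian R R) S
      ⟨_, e₀, ⟨h₀, hJ₀, hne⟩, rfl⟩
  have horth : ∀ f : R, f * f = f → (∀ j ∈ Ring.jacobson R, j * f = 0) → e * f = 0 →
      f * e = 0 → f = 0 := by
    intro f hf hfJ hef hfe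
    by_contra hf0
    have h1 : e * (e + f) = e := by rw [mul_add, he, hef, add_zero]
    have h2 : f * (e + f) = f := by rw [mul_add, hf, hfe, zero_add]
    refine hmax (Submodule.span R {e + f}) ⟨e + f, ⟨?_, ?_, ?_⟩, rfl⟩ (lt_of_le_of_ne ?_ ?_)
    · rw [add_mul, h1, h2]
    · intro j hj
      rw [mul_add, hJ j hj, hfJ j hj, add_zero]
    · intro h
      rw [h, mul_zero] at h2
      exact hf0 h2.symm
    · exact (Submodule.span_singleton_le_iff_mem _ _).2 (Submodule.mem_span_singleton.2 ⟨e, h1⟩)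
    · intro h
      have : f ∈ Submodule.span R {e} := h ▸ Submodule.mem_span_singleton.2 ⟨f, h2⟩
      obtain ⟨r, hr⟩ := Submodule.mem_span_singleton.1 this
      rw [smul_eq_mul] at hr
      rw [← hr, mul_assoc, he, hr] at hfe
      exact hf0 hfe
  have hmul : ∀ {y : R} (a : R), (∀ j ∈ Ring.jacobson R, j * y = 0) →
      ∀ j ∈ Ring.jacobson R, j * (a * y) = 0 := fun a h j hj ↦ by
    rw [← mul_assoc, h _ (Ideal.mul_mem_right a _ hj)]
  have hright : ∀ g : R, g * g = g → (∀ j ∈ Ring.jacobson R, j * g = 0) → g * e = 0 → g = 0 := by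
    intro g hg hgJ hge
    have h := horth ((1 - e) * g)
      (by
        have : (1 - e) * g * ((1 - e) * g) = (1 - e) * (g * g - g * e * g) := by noncomm_ring
        rw [this, hg, hge, zero_mul, sub_zero])
      (hmul _ hgJ)
      (by rw [← mul_assoc, mul_sub, he, mul_one, sub_self, zero_mul])
      (by rw [mul_assoc, hge, mul_zero])
    rw [sub_mul, one_mul, sub_eq_zero] at h
    rw [← hg]
    nth_rewrite 2 [h]
    rw [← mul_assoc, hge, zero_mul]
  have hA : ∀ a, (1 - e) * a * e = 0 := by
    intro a
    set x := (1 - e) * a * e with hxdef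
    have hxe : x * e = x := by rw [hxdef, mul_assoc, he]
    have hex : (1 - e) * x = x := by
      rw [hxdef, ← mul_assoc, ← mul_assoc, sub_mul 1 e (1 - e), mul_sub e, he]
      simp
    have hxJ : ∀ j ∈ Ring.jacobson R, j * x = 0 := hmul _ hJ
    clear_value x
    obtain ⟨b, hb⟩ := exists_mul_mul_self_eq he hJ hxe
    have h := hright (x * (b * (1 - e)))
      (by
        calc x * (b * (1 - e)) * (x * (b * (1 - e))) = x * b * ((1 - e) * x) * (b * (1 - e)) := by
              noncomm_ring
          _ = _ := by rw [hex, hb])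
      (fun j hj ↦ by rw [← mul_assoc, hxJ j hj, zero_mul])
      (by rw [mul_assoc, mul_assoc b, sub_mul, one_mul, he, sub_self, mul_zero, mul_zero])
    rw [← hb]
    nth_rewrite 2 [← hex]
    calc x * b * ((1 - e) * x) = x * (b * (1 - e)) * x := by noncomm_ring
      _ = 0 := by rw [h, zero_mul]
  have hB : ∀ a, e * a * (1 - e) = 0 := by
    intro a
    set x := e * a * (1 - e) with hxdef
    have hxe : e * x = x := by rw [hxdef, ← mul_assoc, ← mul_assoc, he]
    have hx0 : x * e = 0 := by rw [hxdef, mul_assoc, sub_mul, one_mul, he, sub_self, mul_zero]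
    obtain ⟨b, hbe, hb⟩ := exists_mul_mul_self_eq_of_injective hinj he hJ hxe
    have h := hright (b * x)
      (by rw [mul_assoc, ← mul_assoc x, hb])
      (fun j hj ↦ by
        rw [← hbe, ← mul_assoc, hmul b hJ j hj, zero_mul])
      (by rw [mul_assoc, hx0, mul_zero])
    rw [← hb, mul_assoc, h, mul_zero]
  refine ⟨e, he, hJ, hne, fun a ↦ ?_⟩
  have h1 := hA a
  have h2 := hB a
  rw [sub_mul, sub_mul, one_mul, sub_eq_zero] at h1
  rw [mul_sub, mul_one, sub_eq_zero] at h2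
  exact h1.trans h2.symm

/-- An idempotent `e` such that `e` and `1 - e` generate two-sided ideals as left ideals splits
a ring into a product. -/
noncomputable def centralIdempotentEquiv (k : Type v) [Field k] [Algebra k R] (e : R)
    (he : e * e = e)
    [(Ideal.span {e}).IsTwoSided] [(Ideal.span {1 - e}).IsTwoSided] :
    R ≃ₐ[k] (R ⧸ Ideal.span {1 - e}) × (R ⧸ Ideal.span {e}) :=
  AlgEquiv.ofBijective
    ((Ideal.Quotient.mkₐ k (Ideal.span {1 - e})).prod (Ideal.Quotient.mkₐ k (Ideal.span {e}))) <| by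
    constructor
    · rw [injective_iff_map_eq_zero]
      intro a ha
      obtain ⟨h1, h2⟩ := Prod.ext_iff.1 ha
      obtain ⟨r, hr⟩ := Ideal.mem_span_singleton'.1 (Ideal.Quotient.eq_zero_iff_mem.1 h1)
      obtain ⟨s, hs⟩ := Ideal.mem_span_singleton'.1 (Ideal.Quotient.eq_zero_iff_mem.1 h2)
      have h3 : a * e = 0 := by rw [← hr, mul_assoc, sub_mul, one_mul, he, sub_self, mul_zero]
      have h4 : a * e = a := by rw [← hs, mul_assoc, he]
      rw [← h4, h3]
    · rintro ⟨x, y⟩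
      obtain ⟨x, rfl⟩ := Ideal.Quotient.mk_surjective x
      obtain ⟨y, rfl⟩ := Ideal.Quotient.mk_surjective y
      refine ⟨x * e + y * (1 - e), Prod.ext ?_ ?_⟩
      · refine Ideal.Quotient.eq.2 (Ideal.mem_span_singleton'.2 ⟨y - x, ?_⟩)
        noncomm_ring
      · refine Ideal.Quotient.eq.2 (Ideal.mem_span_singleton'.2 ⟨x - y, ?_⟩)
        noncomm_ring

theorem isTwoSided_span_singleton_of_central {e : R} (hc : ∀ a, a * e = e * a) :
    (Ideal.span {e}).IsTwoSided where
  mul_mem_of_left {a} b ha := by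
    obtain ⟨r, rfl⟩ := Ideal.mem_span_singleton'.1 ha
    exact Ideal.mem_span_singleton'.2 ⟨r * b, by rw [mul_assoc, hc, mul_assoc]⟩

end RadicalIdempotents

section Blocks

variable {k : Type v} [Field k] {A : Type u} [Ring A] [Algebra k A]

/-- In a self-injective algebra without semisimple blocks, the only idempotent annihilated by the
radical is zero. -/
theorem eq_zero_of_idempotent_of_jacobson_mul [Module.Finite k A] (hinj : IsSelfInjective A)
    (hblocks : HasNoSemisimpleBlocks k A) (e : Aᵐᵒᵖ) (he : e * e = e)
    (hJ : ∀ j ∈ Ring.jacobson Aᵐᵒᵖ, j * e = 0) : e = 0 := by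
  have : IsArtinianRing Aᵐᵒᵖ := IsArtinianRing.of_finite k _
  have hinj' : Module.Injective Aᵐᵒᵖ Aᵐᵒᵖ := by
    have h : Module.Injective Aᵐᵒᵖ A := hinj
    let l : A ≃ₗ[Aᵐᵒᵖ] Aᵐᵒᵖ :=
      { MulOpposite.opAddEquiv (α := A) with map_smul' := fun _ _ ↦ rfl }
    refine ⟨fun X Y _ _ _ _ f hf g ↦ ?_⟩
    obtain ⟨t, ht⟩ := h.out f hf (l.symm.toLinearMap.comp g)
    exact ⟨l.toLinearMap.comp t, fun x ↦ by simp [ht]⟩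
  by_contra hne
  obtain ⟨e, he, hJ, hne, hc⟩ := exists_central_idempotent hinj' he hJ hne
  have i₁ := isTwoSided_span_singleton_of_central hc
  have i₂ : (Ideal.span {1 - e}).IsTwoSided :=
    isTwoSided_span_singleton_of_central fun a ↦ by rw [mul_sub, sub_mul, hc, mul_one, one_mul]
  let E := centralIdempotentEquiv k e he
  refine hblocks ⟨(Aᵐᵒᵖ ⧸ Ideal.span {1 - e})ᵐᵒᵖ, (Aᵐᵒᵖ ⧸ Ideal.span {e})ᵐᵒᵖ,
    inferInstance, inferInstance, inferInstance, inferInstance, ?_, ?_, ⟨?_⟩⟩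
  · have : Nontrivial (Aᵐᵒᵖ ⧸ Ideal.span {1 - e}) := ?_
    · infer_instance
    refine Ideal.Quotient.nontrivial_iff.2 fun h ↦ hne ?_
    obtain ⟨r, hr⟩ := Ideal.mem_span_singleton'.1 (h ▸ Submodule.mem_top (x := (1 : Aᵐᵒᵖ)))
    rw [← one_mul e, ← hr, mul_assoc, sub_mul, one_mul, he, sub_self, mul_zero]
  · rw [isSemisimpleRing_mulOpposite_iff]
    have hle : Ring.jacobson Aᵐᵒᵖ ≤ Ideal.span {1 - e} := fun j hj ↦
      Ideal.mem_span_singleton'.2 ⟨j, by rw [mul_sub, hJ j hj, mul_one, sub_zero]⟩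
    exact (Ideal.Quotient.factor hle).isSemisimpleRing_of_surjective
      (Ideal.Quotient.factor_surjective hle)
  · let F : A ≃ₐ[k] (Aᵐᵒᵖ)ᵐᵒᵖ := AlgEquiv.opOp k A
    exact
      { toFun := fun a ↦ (.op (E (.op a)).1, .op (E (.op a)).2)
        invFun := fun x ↦ (E.symm (x.1.unop, x.2.unop)).unop
        left_inv := fun a ↦ by simp
        right_inv := fun x ↦ by simp
        map_mul' := fun a b ↦ by simp
        map_add' := fun a b ↦ by simp
        commutes' := fun r ↦ by
          have : MulOpposite.op (algebraMap k A r) = algebraMap k Aᵐᵒᵖ r := rfl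
          rw [this, E.commutes]
          rfl }

end Blocks

section ProjectiveFactorization

variable {R : Type u} [Ring R] {M N : Type u} [AddCommGroup M] [Module R M] [AddCommGroup N]
  [Module R N]

/-- A linear map that factors through a projective module. -/
def LinearMap.FactorsThroughProjective (d : M →ₗ[R] N) : Prop :=
  ∃ (P : Type u) (_ : AddCommGroup P) (_ : Module R P) (_ : Module.Projective R P)
    (g : M →ₗ[R] P) (h : P →ₗ[R] N), d = h ∘ₗ g

theorem FactorsThroughProjective.linearMap {M N : FGModuleCat.{u} R} {f : M ⟶ N}
    (hf : FactorsThroughProjective f) : f.hom.hom.FactorsThroughProjective := by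
  obtain ⟨P, hP, g, h, rfl⟩ := hf
  exact ⟨P, inferInstance, inferInstance, hP, g.hom.hom, h.hom.hom, rfl⟩

/-- If `p` factors through a projective module, then `M` is the sum of a projective submodule and
of a submodule contained in the range of `1 - p`. -/
theorem LinearMap.FactorsThroughProjective.exists_isCompl [IsArtinian R M] [IsNoetherian R M]
    {p : Module.End R M} (hp : LinearMap.FactorsThroughProjective p) :
    ∃ K Q : Submodule R M, IsCompl K Q ∧ Module.Projective R Q ∧ K ≤ LinearMap.range (1 - p) := by
  obtain ⟨P, _, _, _, g, h, hgh⟩ := hp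
  obtain ⟨n, hn, hn1⟩ := (p.eventually_isCompl_ker_pow_range_pow.and
    (Filter.eventually_ge_atTop 1)).exists
  have hps : ∀ x, p x = h (g x) := fun x ↦ by rw [hgh]; rfl
  refine ⟨_, _, hn, ?_, ?_⟩
  · set Q := LinearMap.range (p ^ n) with hQ
    let i : Q →ₗ[R] P := g ∘ₗ Q.subtype
    let s : P →ₗ[R] Q := (p ^ n).rangeRestrict ∘ₗ h
    have hinj : Function.Injective (s ∘ₗ i) := by
      rw [← LinearMap.ker_eq_bot, LinearMap.ker_eq_bot']
      rintro ⟨q, hq⟩ h0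
      have h1 : (p ^ n) (p q) = 0 := by
        have := congrArg Subtype.val h0
        simpa [s, i, hps] using this
      have h2 : p q ∈ Q := by
        obtain ⟨m, rfl⟩ := hq
        exact ⟨p m, by rw [← Module.End.mul_apply, ← Module.End.mul_apply, pow_mul_comm']⟩
      have h3 : p q = 0 := Submodule.disjoint_def.1 hn.disjoint _ h1 h2
      have h4 : (p ^ n) q = 0 := by
        obtain ⟨m, rfl⟩ : ∃ m, n = m + 1 := ⟨n - 1, by omega⟩
        rw [pow_succ, Module.End.mul_apply, h3, map_zero]
      exact Subtype.ext (Submodule.disjoint_def.1 hn.disjoint _ h4 hq)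
    let E := LinearEquiv.ofBijective (s ∘ₗ i)
      (IsArtinian.bijective_of_injective_endomorphism _ hinj)
    refine Module.Projective.of_split (M := P) i (E.symm.toLinearMap ∘ₗ s) ?_
    ext1 q
    exact E.symm_apply_apply q
  · intro x hx
    refine ⟨(∑ i ∈ Finset.range n, p ^ i) x, ?_⟩
    rw [← Module.End.mul_apply, mul_neg_geom_sum, LinearMap.sub_apply, LinearMap.mem_ker.1 hx,
      sub_zero]
    rfl

variable (R) in
/-- No nonzero idempotent of `R` is annihilated by the Jacobson radical. -/
def NoRadicalFreeIdempotents : Prop :=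
  ∀ e : R, e * e = e → (∀ j ∈ Ring.jacobson R, j * e = 0) → e = 0

theorem eq_bot_of_projective_of_jacobson_smul [IsSemiprimaryRing R]
    (H : NoRadicalFreeIdempotents R) [Module.Projective R M]
    (hJ : ∀ j ∈ Ring.jacobson R, ∀ m : M, j • m = 0) (q : M) : q = 0 := by
  have := isSemisimpleModule_of_jacobson_smul hJ
  obtain ⟨C, hC⟩ := exists_isCompl (Submodule.span R {q})
  have : Module.Projective R (Submodule.span R {q}) :=
    .of_split (Submodule.subtype _) (Submodule.projectionOnto _ C hC)
      (Submodule.projectionOnto_comp_subtype hC)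
  let q' : Submodule.span R {q} := ⟨q, Submodule.mem_span_singleton_self q⟩
  let f := LinearMap.toSpanSingleton R _ q'
  have hf : LinearMap.range f = ⊤ := by
    rw [eq_top_iff]
    rintro ⟨x, hx⟩ -
    obtain ⟨r, rfl⟩ := Submodule.mem_span_singleton.1 hx
    exact ⟨r, rfl⟩
  obtain ⟨s, hs⟩ := f.exists_rightInverse_of_surjective hf
  have hq : s q' • q' = q' := LinearMap.congr_fun hs q'
  have h0 : s q' = 0 := by
    refine H _ ?_ fun j hj ↦ ?_
    · rw [← smul_eq_mul, ← map_smul, hq]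
    · rw [← smul_eq_mul, ← map_smul]
      have : j • q' = 0 := Subtype.ext (hJ j hj q)
      rw [this, map_zero]
  rw [h0, zero_smul] at hq
  exact (congrArg Subtype.val hq).symm

/-- A map with a stable right inverse, onto a module annihilated by the radical, is surjective. -/
theorem surjective_of_stable_rightInverse [IsArtinianRing R] (H : NoRadicalFreeIdempotents R)
    [Module.Finite R M] (hJ : ∀ j ∈ Ring.jacobson R, ∀ m : M, j • m = 0) {f : N →ₗ[R] M}
    {g : M →ₗ[R] N} (hfg : (1 - f ∘ₗ g : Module.End R M).FactorsThroughProjective) :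
    Function.Surjective f := by
  obtain ⟨K, Q, hKQ, hQ, hK⟩ := hfg.exists_isCompl
  have hQ0 : Q = ⊥ := by
    rw [eq_bot_iff]
    intro q hq
    exact congrArg Subtype.val (eq_bot_of_projective_of_jacobson_smul H
      (fun j hj m ↦ Subtype.ext (hJ j hj m)) (⟨q, hq⟩ : Q))
  have hKt : K = ⊤ := by rw [← hKQ.sup_eq_top, hQ0, sup_bot_eq]
  intro m
  obtain ⟨x, hx⟩ := hK (hKt ▸ Submodule.mem_top (x := m))
  rw [sub_sub_cancel] at hx
  exact ⟨g x, hx⟩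

/-- A map `M_σ → M` with a stable right inverse, stably compatible with the endomorphisms of `M`. -/
structure StableTwistSplitting (σ : R ≃+* R) (M : Type u) [AddCommGroup M] [Module R M] where
  /-- The map `M_σ → M`. -/
  hom : Twist σ M →ₗ[R] M
  /-- The map `M → M_σ`. -/
  inv : M →ₗ[R] Twist σ M
  hom_inv : (1 - hom ∘ₗ inv : Module.End R M).FactorsThroughProjective
  naturality (m : M →ₗ[R] M) : (hom ∘ₗ Twist.map σ m - m ∘ₗ hom).FactorsThroughProjective

theorem nonempty_stableTwistSplitting {σ : R ≃+* R} (η : stableResFunctor σ ≅ 𝟭 (StableModuleCat R))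
    (M : Type u) [AddCommGroup M] [Module R M] [Module.Finite R M] :
    Nonempty (StableTwistSplitting σ M) := by
  let X : FGModuleCat.{u} R := FGModuleCat.of R M
  let F := CategoryTheory.Quotient.functor (stableRel R)
  obtain ⟨f, hf⟩ := F.map_surjective (X := (resFunctor σ).obj X) (Y := X) (η.hom.app (F.obj X))
  obtain ⟨g, hg⟩ := F.map_surjective (X := X) (Y := (resFunctor σ).obj X) (η.inv.app (F.obj X))
  refine ⟨⟨f.hom.hom, g.hom.hom, ?_, fun m ↦ ?_⟩⟩
  · have : F.map (𝟙 X) = F.map (g ≫ f) := by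
      rw [F.map_comp, hf, hg, F.map_id]
      exact (η.inv_hom_id_app (F.obj X)).symm
    exact ((CategoryTheory.Quotient.functor_map_eq_iff _ _ _).1 this).linearMap
  · let m' : X ⟶ X := FGModuleCat.ofHom m
    have : F.map ((resFunctor σ).map m' ≫ f) = F.map (f ≫ m') := by
      rw [F.map_comp, F.map_comp, hf]
      exact η.hom.naturality (F.map m')
    exact ((CategoryTheory.Quotient.functor_map_eq_iff _ _ _).1 this).linearMap

/-- A projective module is a quotient of its twist. -/
theorem exists_surjective_twist [IsArtinianRing R] (H : NoRadicalFreeIdempotents R)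
    {σ : R ≃+* R}
    (S : ∀ (M : Type u) [AddCommGroup M] [Module R M] [Module.Finite R M],
      Nonempty (StableTwistSplitting σ M))
    (P : Type u) [AddCommGroup P] [Module R P] [Module.Finite R P] [Module.Projective R P] :
    ∃ l : Twist σ P →ₗ[R] P, Function.Surjective l := by
  let JP : Submodule R P := Ring.jacobson R • ⊤
  obtain ⟨s⟩ := S (P ⧸ JP)
  have hsurj : Function.Surjective s.hom := by
    refine surjective_of_stable_rightInverse H (fun j hj m ↦ ?_) s.hom_inv
    obtain ⟨p, rfl⟩ := JP.mkQ_surjective m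
    rw [← map_smul]
    exact (Submodule.Quotient.mk_eq_zero _).2 (Submodule.smul_mem_smul hj Submodule.mem_top)
  obtain ⟨l, hl⟩ := Module.projective_lifting_property JP.mkQ (s.hom ∘ₗ Twist.map σ JP.mkQ)
    JP.mkQ_surjective
  refine ⟨l, LinearMap.range_eq_top.1 ?_⟩
  have htop : LinearMap.range l ⊔ JP = ⊤ := by
    rw [eq_top_iff]
    rintro p -
    obtain ⟨t, ht⟩ := hsurj (JP.mkQ p)
    obtain ⟨t, rfl⟩ := (Twist.equiv σ _).surjective t
    obtain ⟨x, rfl⟩ := JP.mkQ_surjective t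
    have h1 : JP.mkQ (l (Twist.equiv σ P x)) = JP.mkQ p :=
      (LinearMap.congr_fun hl (Twist.equiv σ P x)).trans ht
    have h2 : p - l (Twist.equiv σ P x) ∈ JP := (Submodule.Quotient.eq _).1 h1.symm
    rw [← add_sub_cancel (l (Twist.equiv σ P x)) p]
    exact Submodule.add_mem_sup ⟨_, rfl⟩ h2
  by_contra hne
  have : Nontrivial (P ⧸ LinearMap.range l) := Submodule.Quotient.nontrivial_iff.2 hne
  refine (Submodule.jacobson_smul_lt_top (R := R) (⊤ : Submodule R (P ⧸ LinearMap.range l))).ne ?_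
  have h := congrArg (Submodule.map (LinearMap.range l).mkQ) htop
  rwa [Submodule.map_sup, Submodule.mkQ_map_self, bot_sup_eq, Submodule.map_smul'',
    Submodule.map_top, Submodule.range_mkQ] at h

/-- The annihilator of `M_σ` is contained in that of `M`. -/
theorem smul_eq_zero_of_twist [IsArtinianRing R] (H : NoRadicalFreeIdempotents R)
    {σ : R ≃+* R}
    (S : ∀ (M : Type u) [AddCommGroup M] [Module R M] [Module.Finite R M],
      Nonempty (StableTwistSplitting σ M))
    [Module.Finite R M] {r : R} (hr : ∀ m : M, σ r • m = 0) (m : M) : r • m = 0 := by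
  obtain ⟨s⟩ := S M
  obtain ⟨K, Q, hKQ, hQ, hK⟩ := s.hom_inv.exists_isCompl
  obtain ⟨a, ha, b, hb, rfl⟩ := Submodule.mem_sup.1 (hKQ.sup_eq_top ▸ Submodule.mem_top (x := m))
  have htw : ∀ t : Twist σ M, r • t = 0 := fun t ↦ hr ((Twist.equiv σ M).symm t)
  rw [smul_add]
  have h1 : r • a = 0 := by
    obtain ⟨x, hx⟩ := hK ha
    rw [sub_sub_cancel] at hx
    rw [← hx, LinearMap.comp_apply, ← map_smul, htw, map_zero]
  have h2 : r • b = 0 := by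
    obtain ⟨l, hl⟩ := exists_surjective_twist H S Q
    obtain ⟨t, ht⟩ := hl ⟨b, hb⟩
    have h3 : r • t = 0 := Subtype.ext (hr _)
    have := congrArg Subtype.val (congrArg (r • ·) ht)
    simp only [← map_smul, h3, map_zero] at this
    exact this.symm
  rw [h1, h2, add_zero]

variable {I : Ideal R}

/-- A map to `R ⧸ I` through a projective module sends elements killed by `I` to classes of
elements of the right annihilator of `I`. -/
theorem LinearMap.FactorsThroughProjective.exists_mk_eq {d : M →ₗ[R] R ⧸ I}
    (hd : d.FactorsThroughProjective) {n : M} (hn : ∀ x ∈ I, x • n = 0) :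
    ∃ c : R, (∀ x ∈ I, x * c = 0) ∧ d n = Submodule.Quotient.mk c := by
  obtain ⟨P, _, _, _, g, h, rfl⟩ := hd
  obtain ⟨h', hh⟩ := Module.projective_lifting_property I.mkQ h I.mkQ_surjective
  refine ⟨h' (g n), fun x hx ↦ ?_, ?_⟩
  · rw [← smul_eq_mul, ← map_smul, ← map_smul, hn x hx, map_zero, map_zero]
  · exact (LinearMap.congr_fun hh (g n)).symm

/-- If `I` is stable under `σ`, then `σ⁻¹` is conjugation modulo `I` and its right annihilator. -/
theorem exists_conjugating_element {σ : R ≃+* R} [I.IsTwoSided] (hI : ∀ x, σ x ∈ I ↔ x ∈ I)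
    (s : StableTwistSplitting σ (R ⧸ I)) (K : Ideal R) (hIK : I ≤ K)
    (hK : ∀ c, (∀ x ∈ I, x * c = 0) → c ∈ K) :
    ∃ w z : R, z * w - 1 ∈ K ∧ ∀ b, b * w - w * σ b ∈ K := by
  let ε := Twist.equiv σ (R ⧸ I)
  have hmem : ∀ (d : R), (∃ c : R, (∀ x ∈ I, x * c = 0) ∧
      (Submodule.Quotient.mk d : R ⧸ I) = Submodule.Quotient.mk c) → d ∈ K := by
    rintro d ⟨c, hc, hdc⟩
    rw [← sub_add_cancel d c]
    exact K.add_mem (hIK ((Submodule.Quotient.eq _).1 hdc)) (hK c hc)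
  have hsm : ∀ r y : R, r • (Submodule.Quotient.mk y : R ⧸ I) = Submodule.Quotient.mk (r * y) :=
    fun _ _ ↦ rfl
  have hkill : ∀ y : R ⧸ I, ∀ x ∈ I, x • y = 0 := by
    intro y x hx
    obtain ⟨y, rfl⟩ := I.mkQ_surjective y
    exact (Submodule.Quotient.mk_eq_zero _).2 (Ideal.mul_mem_right y _ hx)
  have hkill' : ∀ y : Twist σ (R ⧸ I), ∀ x ∈ I, x • y = 0 := fun y x hx ↦
    hkill ((Twist.equiv σ _).symm y) (σ x) ((hI x).2 hx)
  have hε : ∀ r : R, ε (Submodule.Quotient.mk r) = σ.symm r • ε (Submodule.Quotient.mk 1) := by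
    intro r
    rw [← Twist.equiv_smul, hsm, mul_one]
  obtain ⟨u, hu⟩ := I.mkQ_surjective (s.hom (ε (Submodule.Quotient.mk 1)))
  obtain ⟨v, hv⟩ := I.mkQ_surjective (ε.symm (s.inv (Submodule.Quotient.mk 1)))
  replace hu : s.hom (ε (Submodule.Quotient.mk 1)) = Submodule.Quotient.mk u := hu.symm
  replace hv : s.inv (Submodule.Quotient.mk 1) = ε (Submodule.Quotient.mk v) := by
    rw [← ε.symm_apply_eq]; exact hv.symm
  have hhom : ∀ r, s.hom (ε (Submodule.Quotient.mk r)) = Submodule.Quotient.mk (σ.symm r * u) := by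
    intro r
    rw [hε, map_smul, hu, hsm]
  refine ⟨u, σ.symm v, hmem _ ?_, fun b ↦ ?_⟩
  · obtain ⟨c, hc, hdc⟩ := s.hom_inv.exists_mk_eq (hkill (Submodule.Quotient.mk 1))
    refine ⟨-c, fun x hx ↦ by rw [mul_neg, hc x hx, neg_zero], ?_⟩
    rw [LinearMap.sub_apply, LinearMap.comp_apply, hv, hhom] at hdc
    rw [Submodule.Quotient.mk_neg, ← hdc, neg_sub, Submodule.Quotient.mk_sub]
    rfl
  · obtain ⟨b, rfl⟩ := σ.symm.surjective b
    rw [σ.apply_symm_apply]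
    let ρ : R ⧸ I →ₗ[R] R ⧸ I := I.mapQ I (LinearMap.toSpanSingleton R R b)
      fun x hx ↦ Ideal.mul_mem_right b _ hx
    obtain ⟨c, hc, hdc⟩ := (s.naturality ρ).exists_mk_eq
      (hkill' (ε (Submodule.Quotient.mk 1)))
    refine hmem _ ⟨c, hc, ?_⟩
    have h1 : Twist.map σ ρ (ε (Submodule.Quotient.mk 1)) = ε (Submodule.Quotient.mk b) :=
      congrArg (fun y : R ↦ ε (Submodule.Quotient.mk y)) (one_mul b)
    rw [LinearMap.sub_apply, LinearMap.comp_apply, LinearMap.comp_apply, h1, hhom, hu] at hdc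
    rw [← hdc, Submodule.Quotient.mk_sub]
    rfl

end ProjectiveFactorization

section OppositeIdeals

variable {A : Type u} [Ring A]

/-- A two-sided ideal of `A` as a left ideal of the opposite ring. -/
def oppositeIdeal (I : Ideal A) [I.IsTwoSided] : Ideal Aᵐᵒᵖ where
  carrier := {x | x.unop ∈ I}
  zero_mem' := I.zero_mem
  add_mem' := I.add_mem
  smul_mem' c _ hx := I.mul_mem_right c.unop hx

instance (I : Ideal A) [I.IsTwoSided] : (oppositeIdeal I).IsTwoSided where
  mul_mem_of_left b ha := I.mul_mem_left b.unop ha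

end OppositeIdeals

/-- Conjugation `x ↦ u x u⁻¹` as an algebra automorphism. -/
def conjAlgEquiv (k : Type*) {B : Type*} [CommSemiring k] [Ring B] [Algebra k B] (u : Bˣ) :
    B ≃ₐ[k] B where
  toFun x := u * x * ↑u⁻¹
  invFun x := ↑u⁻¹ * x * u
  left_inv x := by simp [mul_assoc]
  right_inv x := by simp [mul_assoc]
  map_mul' x y := by simp [mul_assoc]
  map_add' x y := by simp [mul_add, add_mul]
  commutes' r := by rw [← Algebra.commutes, mul_assoc, Units.mul_inv, mul_one]

theorem corollary2 {k : Type v} [Field k] {A : Type u} [Ring A] [Algebra k A]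
    [Module.Finite k A] (hinj : IsSelfInjective A) (hblocks : HasNoSemisimpleBlocks k A)
    (I : Ideal A) [I.IsTwoSided] (φ : A ≃ₐ[k] A) (hφ : IsStablyInner φ) :
    φ '' (I : Set A) = (I : Set A) ∧
    ∃ ψ : (A ⧸ (leftAnnihilator I ⊔ I)) ≃ₐ[k] (A ⧸ (leftAnnihilator I ⊔ I)),
      (∀ a : A, ψ (Ideal.Quotient.mk (leftAnnihilator I ⊔ I) a) =
        Ideal.Quotient.mk (leftAnnihilator I ⊔ I) (φ a)) ∧
      IsInnerAut ψ := by
  have : IsArtinianRing Aᵐᵒᵖ := IsArtinianRing.of_finite k _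
  have H : NoRadicalFreeIdempotents Aᵐᵒᵖ := eq_zero_of_idempotent_of_jacobson_mul hinj hblocks
  obtain ⟨η⟩ := hφ
  have S := nonempty_stableTwistSplitting η
  have hle : ∀ a, φ a ∈ I → a ∈ I := by
    intro a ha
    have h := smul_eq_zero_of_twist H S (M := Aᵐᵒᵖ ⧸ oppositeIdeal I) (r := .op a) (fun m ↦ by
      obtain ⟨m, rfl⟩ := (oppositeIdeal I).mkQ_surjective m
      exact (Submodule.Quotient.mk_eq_zero _).2 (I.mul_mem_left m.unop ha))
      (Submodule.Quotient.mk 1)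
    have h' : MulOpposite.op a * 1 ∈ oppositeIdeal I := (Submodule.Quotient.mk_eq_zero _).1 h
    rwa [mul_one] at h'
  have hiff : ∀ a, φ a ∈ I ↔ a ∈ I := by
    refine fun a ↦ ⟨hle a, fun ha ↦ ?_⟩
    let V : Submodule k A := I.restrictScalars k
    have hV : V.map (φ.symm.toLinearEquiv : A →ₗ[k] A) = V := by
      refine Submodule.eq_of_le_of_finrank_eq ?_ (LinearEquiv.finrank_map_eq _ V)
      rintro _ ⟨x, hx, rfl⟩
      have hx' : x ∈ I := hx
      exact hle _ (by simpa using hx')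
    have ha' : a ∈ V := ha
    rw [← hV] at ha'
    obtain ⟨x, hx, rfl⟩ := ha'
    have hx' : x ∈ I := hx
    simpa using hx'
  refine ⟨?_, ?_⟩
  · ext a
    constructor
    · rintro ⟨x, hx, rfl⟩
      exact (hiff x).2 hx
    · intro ha
      exact ⟨φ.symm a, (hiff _).1 (by simpa using ha), φ.apply_symm_apply a⟩
  · set K := leftAnnihilator I ⊔ I with hK
    obtain ⟨s⟩ := S (Aᵐᵒᵖ ⧸ oppositeIdeal I)
    obtain ⟨w, z, hzw, hconj⟩ := exists_conjugating_element (I := oppositeIdeal I)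
      (fun x ↦ hiff x.unop) s (oppositeIdeal K)
      (fun x hx ↦ (le_sup_right : I ≤ K) hx)
      (fun c hc ↦ (le_sup_left : leftAnnihilator I ≤ K)
        fun x hx ↦ congrArg MulOpposite.unop (hc (.op x) hx))
    have : IsArtinianRing (A ⧸ K) := IsArtinianRing.of_finite k _
    let π := Ideal.Quotient.mk K
    have hwz : π w.unop * π z.unop = 1 := by
      rw [← map_mul, ← map_one π]
      exact Ideal.Quotient.eq.2 hzw
    let u : (A ⧸ K)ˣ := ⟨π w.unop, π z.unop, hwz, mul_eq_one_comm.1 hwz⟩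
    refine ⟨conjAlgEquiv k u, fun a ↦ ?_, u⁻¹, fun x ↦ by rw [inv_inv]; rfl⟩
    have h : π w.unop * π a = π (φ a) * π w.unop := by
      rw [← map_mul, ← map_mul]
      exact Ideal.Quotient.eq.2 (hconj (.op a))
    exact (Units.mul_inv_eq_iff_eq_mul u).2 h
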